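/- **Theorem 3.8 (uniqueness of minimizers).** Let $\Omega\subset\mathbb R^n$, $n\ge 2$, be a bounded domain (nonempty, open, connected), let $1<p<\infty$, and let $\omega\in A_p$, that is, $\omega:\mathbb R^n\to[0,\infty)$ is locally integrable, positive almost everywhere, and $$[\omega]_{A_p}:=\sup_{B}\Big(\frac1{|B|}\int_B\omega\,dx\Big)\Big(\frac1{|B|}\int_B\omega^{-\frac1{p-1}}\,dx\Big)^{p-1}<\infty ,$$ the supremum being over all balls $B\subset\mathbb R^n$. Let $\phi\in\Phi_c(\Omega)$, that is, $\phi:\Omega\times[0,\infty)\to[0,\infty]$ is such that $x\mapsto\phi(x,|f(x)|)$ is measurable for every measurable $f:\Omega\to\mathbb R$ and such that, for every $x\in\Omega$, the function $t\mapsto\phi(x,t)$ is nondecreasing, left-continuous and convex with $\phi(x,0)=\lim_{t\to0^+}\phi(x,t)=0$ and $\lim_{t\to\infty}\phi(x,t)=\infty$. Assume that * $\phi$ is strictly convex: for every $x\in\Omega$, $\phi(x,as+(1-a)t)<a\,\phi(x,s)+(1-a)\,\phi(x,t)$ whenever $s\ne t$, $\phi(x,s),\phi(x,t)<\infty$ and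 $0<a<1$; * $\phi$ satisfies (A0): there is $\beta_0\in(0,1]$ with $\beta_0\le\inf\{\tau\ge0:\phi(x,\tau)\ge1\}\le 1/\beta_0$ for almost every $x\in\Omega$; * $\phi$ satisfies (aInc)$_p$ with the same $p$: there is $L\ge1$ with $s^{-p}\phi(x,s)\le L\,t^{-p}\phi(x,t)$ for all $x\in\Omega$ and $0<s\le t$. Put $\psi(x,t):=\phi(x,t)\,\omega(x)$. For measurable scalar or vector functions $f$ on $\Omega$ let $\|f\|_{L^\psi(\Omega)}:=\inf\{\lambda>0:\int_\Omega\psi(x,|f(x)|/\lambda)\,dx\le1\}$, let $L^\psi(\Omega)$ be the set of those with $\|f\|_{L^\psi(\Omega)}<\infty$, let $W^{1,\psi}(\Omega)$ be the set of $f\in L^\psi(\Omega)\cap L^1_{\mathrm{loc}}(\Omega)$ whose weak gradient $\nabla f$ exists (in $L^1_{\mathrm{loc}}(\Omega)$) and lies in $L^\psi(\Omega)$, with norm $\|f\|_{L^\psi(\Omega)}+\||\nabla f|\|_{L^\psi(\Omega)}$, and let $W^{1,\psi}_0(\Omega)$ be the closure of $C_0^\infty(\Omega)$ in $W^{1,\psi}(\Omega)$.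 Let $I_\psi(u):=\int_\Omega\psi(x,|\nabla u|)\,dx$. Let $z\in W^{1,\psi}(\Omega)$ be such that $I_\psi(v)<\infty$ for some $v\in z+W^{1,\psi}_0(\Omega)$. If $u_1,u_2\in z+W^{1,\psi}_0(\Omega)$ satisfy $$I_\psi(u_1)=I_\psi(u_2)=\inf_{v\in z+W_0^{1,\psi}(\Omega)}I_\psi(v),$$ then $u_1=u_2$ almost everywhere in $\Omega$. -/

import Mathlib

open MeasureTheory Set Filter Topology
open scoped NNReal ENNReal

noncomputable section

namespace WeightedOrlicz

/-- The Euclidean space `ℝⁿ`. -/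
abbrev E (n : ℕ) : Type := EuclideanSpace ℝ (Fin n)

variable {n : ℕ}

/-! ### Muckenhoupt weights -/

/-- The Muckenhoupt constant `[ω]_{A_p}`, the supremum over all balls `B` of
`(⨍_B ω) (⨍_B ω^{-1/(p-1)})^{p-1}`, as an extended nonnegative number
(with `0^{-1/(p-1)} = ∞`). -/
def apConst (p : ℝ) (ω : E n → ℝ) : ℝ≥0∞ :=
  ⨆ (x : E n) (r : ℝ) (_ : 0 < r),
    (⨍⁻ y in Metric.ball x r, ENNReal.ofReal (ω y) ∂volume) *
      (⨍⁻ y in Metric.ball x r, ENNReal.ofReal (ω y) ^ (-(1 / (p - 1))) ∂volume) ^ (p - 1)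

/-- `ω ∈ A_p`: a nonnegative, locally integrable weight on `ℝⁿ` with `[ω]_{A_p} < ∞`.
Positivity almost everywhere only excludes the weight that vanishes almost everywhere, for which
the product in `apConst` is `0 * ∞`; every other nonnegative weight with finite constant is
positive almost everywhere. -/
structure IsMuckenhoupt (p : ℝ) (ω : E n → ℝ) : Prop where
  nonneg : ∀ x, 0 ≤ ω x
  locallyIntegrable : LocallyIntegrable ω volume
  ae_pos : ∀ᵐ x, 0 < ω x
  apConst_lt_top : apConst p ω < ⊤

/-! ### Generalized `Φ`-functions

A function `φ : Ω × [0, ∞) → [0, ∞]` is represented by a map `E n → ℝ≥0 → ℝ≥0∞`, of which only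
the values at `x ∈ Ω` are relevant. Measurable means Lebesgue measurable, that is,
`AEMeasurable` for the Lebesgue measure restricted to `Ω`. -/

/-- `φ` is a `Φ`-prefunction on `Ω`. -/
structure IsPhiPrefunction (Ω : Set (E n)) (φ : E n → ℝ≥0 → ℝ≥0∞) : Prop where
  measurable : ∀ f : E n → ℝ, AEMeasurable f (volume.restrict Ω) →
    AEMeasurable (fun x => φ x ‖f x‖₊) (volume.restrict Ω)
  monotone : ∀ x ∈ Ω, Monotone (φ x)
  map_zero : ∀ x ∈ Ω, φ x 0 = 0
  tendsto_zero : ∀ x ∈ Ω, Tendsto (φ x) (𝓝[>] 0) (𝓝 0)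
  tendsto_top : ∀ x ∈ Ω, Tendsto (φ x) atTop (𝓝 ⊤)

/-- `φ ∈ Φ_c(Ω)`: a `Φ`-prefunction that is left-continuous and convex in the second variable. -/
structure IsConvexPhi (Ω : Set (E n)) (φ : E n → ℝ≥0 → ℝ≥0∞) : Prop
    extends IsPhiPrefunction Ω φ where
  leftContinuous : ∀ x ∈ Ω, ∀ t, ContinuousWithinAt (φ x) (Iic t) t
  convex : ∀ x ∈ Ω, ∀ s t a b : ℝ≥0, a + b = 1 →
    φ x (a * s + b * t) ≤ a * φ x s + b * φ x t

/-- Strict convexity of the extended-valued functions `t ↦ φ x t`, `x ∈ Ω`: the convexity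
inequality is strict between distinct points at which the function is finite. -/
def IsStrictlyConvexPhi (Ω : Set (E n)) (φ : E n → ℝ≥0 → ℝ≥0∞) : Prop :=
  ∀ x ∈ Ω, ∀ s t a b : ℝ≥0, s ≠ t → φ x s ≠ ⊤ → φ x t ≠ ⊤ → 0 < a → 0 < b → a + b = 1 →
    φ x (a * s + b * t) < a * φ x s + b * φ x t

/-- The left-continuous inverse `φ⁻¹(x, t) = inf {τ ≥ 0 : φ(x, τ) ≥ t}`
(`∞` if there is no such `τ`). -/
def phiInv (φ : E n → ℝ≥0 → ℝ≥0∞) (x : E n) (t : ℝ≥0∞) : ℝ≥0∞ :=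
  ⨅ (τ : ℝ≥0) (_ : t ≤ φ x τ), (τ : ℝ≥0∞)

/-- Condition (A0): there is `β ∈ (0, 1]` with `β ≤ φ⁻¹(x, 1) ≤ 1 / β` for almost every
`x ∈ Ω`. -/
def CondA0 (Ω : Set (E n)) (φ : E n → ℝ≥0 → ℝ≥0∞) : Prop :=
  ∃ β : ℝ≥0, 0 < β ∧ β ≤ 1 ∧
    ∀ᵐ x ∂(volume.restrict Ω), (β : ℝ≥0∞) ≤ phiInv φ x 1 ∧ phiInv φ x 1 ≤ (β : ℝ≥0∞)⁻¹

/-- Condition (aInc)_p: for some `L ≥ 1` and every `x ∈ Ω` the function `t ↦ t^{-p} φ(x, t)` is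
almost increasing on `(0, ∞)` with constant `L`. -/
def CondAInc (p : ℝ) (Ω : Set (E n)) (φ : E n → ℝ≥0 → ℝ≥0∞) : Prop :=
  ∃ L : ℝ≥0, 1 ≤ L ∧ ∀ x ∈ Ω, ∀ s t : ℝ≥0, 0 < s → s ≤ t →
    (s : ℝ≥0∞) ^ (-p) * φ x s ≤ L * ((t : ℝ≥0∞) ^ (-p) * φ x t)

/-- The weighted function `ψ(x, t) = φ(x, t) ω(x)`. -/
def weighted (φ : E n → ℝ≥0 → ℝ≥0∞) (ω : E n → ℝ) : E n → ℝ≥0 → ℝ≥0∞ :=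
  fun x t => φ x t * ENNReal.ofReal (ω x)

/-! ### Generalized Orlicz and Orlicz-Sobolev spaces -/

/-- The modular `∫_Ω ψ(x, |f(x)|) dx` of a scalar- or vector-valued function. -/
def modular {F : Type*} [NormedAddCommGroup F] (Ω : Set (E n)) (ψ : E n → ℝ≥0 → ℝ≥0∞)
    (f : E n → F) : ℝ≥0∞ :=
  ∫⁻ x in Ω, ψ x ‖f x‖₊

/-- The Luxemburg norm `inf {l > 0 : ∫_Ω ψ(x, |f(x)| / l) dx ≤ 1}` (`∞` if there is no such
`l`). -/
def luxNorm {F : Type*} [NormedAddCommGroup F] [NormedSpace ℝ F] (Ω : Set (E n))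
    (ψ : E n → ℝ≥0 → ℝ≥0∞) (f : E n → F) : ℝ≥0∞ :=
  ⨅ (l : ℝ≥0) (_ : 0 < l) (_ : modular Ω ψ (fun x => (l : ℝ)⁻¹ • f x) ≤ 1), (l : ℝ≥0∞)

/-- `f ∈ L^ψ(Ω)`: `f` is measurable on `Ω` with finite Luxemburg norm. -/
def MemLPhi {F : Type*} [NormedAddCommGroup F] [NormedSpace ℝ F] (Ω : Set (E n))
    (ψ : E n → ℝ≥0 → ℝ≥0∞) (f : E n → F) : Prop :=
  AEStronglyMeasurable f (volume.restrict Ω) ∧ luxNorm Ω ψ f < ⊤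

/-- `η ∈ C_0^∞(Ω)`: smooth with compact support contained in `Ω`. -/
structure IsTestFunction (Ω : Set (E n)) (η : E n → ℝ) : Prop where
  contDiff : ContDiff ℝ ((⊤ : ℕ∞) : WithTop ℕ∞) η
  hasCompactSupport : HasCompactSupport η
  tsupport_subset : tsupport η ⊆ Ω

/-- `g` is a weak gradient of `u` in `Ω`: both are locally integrable in `Ω` and
`∫_Ω u ∂_v η = - ∫_Ω (g · v) η` for all directions `v` and all test functions `η`. -/
structure HasWeakGradient (Ω : Set (E n)) (u : E n → ℝ) (g : E n → E n) : Prop where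
  locallyIntegrableOn : LocallyIntegrableOn u Ω volume
  locallyIntegrableOn_grad : LocallyIntegrableOn g Ω volume
  integral_eq : ∀ η : E n → ℝ, IsTestFunction Ω η → ∀ v : E n,
    ∫ x in Ω, u x * fderiv ℝ η x v = -∫ x in Ω, inner ℝ (g x) v * η x

open Classical in
/-- The weak gradient `∇u` of `u` in `Ω`; it is determined up to a null subset of the open set `Ω`
if it exists, and is `0` otherwise. -/
def weakGrad (Ω : Set (E n)) (u : E n → ℝ) : E n → E n :=
  if h : ∃ g, HasWeakGradient Ω u g then h.choose else 0

/-- The norm `‖f‖_{L^ψ(Ω)} + ‖|∇f|‖_{L^ψ(Ω)}` of `W^{1,ψ}(Ω)`. -/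
def sobolevNorm (Ω : Set (E n)) (ψ : E n → ℝ≥0 → ℝ≥0∞) (f : E n → ℝ) : ℝ≥0∞ :=
  luxNorm Ω ψ f + luxNorm Ω ψ (weakGrad Ω f)

/-- `f ∈ W^{1,ψ}(Ω)`: `f ∈ L^ψ(Ω) ∩ L^1_loc(Ω)` has a weak gradient, which lies in `L^ψ(Ω)`. -/
structure MemW1 (Ω : Set (E n)) (ψ : E n → ℝ≥0 → ℝ≥0∞) (f : E n → ℝ) : Prop where
  exists_grad : ∃ g, HasWeakGradient Ω f g
  memLPhi : MemLPhi Ω ψ f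
  memLPhi_grad : MemLPhi Ω ψ (weakGrad Ω f)

/-- `f ∈ W_0^{1,ψ}(Ω)`, the closure of `C_0^∞(Ω)` in `W^{1,ψ}(Ω)`. -/
structure MemW10 (Ω : Set (E n)) (ψ : E n → ℝ≥0 → ℝ≥0∞) (f : E n → ℝ) : Prop where
  memW1 : MemW1 Ω ψ f
  exists_approx : ∀ ε : ℝ≥0∞, 0 < ε →
    ∃ η : E n → ℝ, IsTestFunction Ω η ∧ sobolevNorm Ω ψ (fun x => f x - η x) < ε

/-! ### The minimization problem -/

/-- The `ψ`-energy `I_ψ(u) = ∫_Ω ψ(x, |∇u|) dx`. -/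
def energy (Ω : Set (E n)) (ψ : E n → ℝ≥0 → ℝ≥0∞) (u : E n → ℝ) : ℝ≥0∞ :=
  modular Ω ψ (weakGrad Ω u)

/-- The class `z + W_0^{1,ψ}(Ω)` of functions with boundary values `z`. -/
def admissible (Ω : Set (E n)) (ψ : E n → ℝ≥0 → ℝ≥0∞) (z : E n → ℝ) : Set (E n → ℝ) :=
  {u | MemW10 Ω ψ (fun x => u x - z x)}

/-- `u ∈ z + W_0^{1,ψ}(Ω)` with `I_ψ(u) = inf_{v ∈ z + W_0^{1,ψ}(Ω)} I_ψ(v)`. -/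
def IsMinimizer (Ω : Set (E n)) (ψ : E n → ℝ≥0 → ℝ≥0∞) (z u : E n → ℝ) : Prop :=
  u ∈ admissible Ω ψ z ∧ energy Ω ψ u = ⨅ v ∈ admissible Ω ψ z, energy Ω ψ v

end WeightedOrlicz

end

/-!
Two minimizers `u₁`, `u₂` have the same weak gradient, and a function of `z + W_0^{1,ψ}(Ω)` is
determined by its weak gradient.

*Equality of gradients.* The midpoint `m` of `u₁` and `u₂` is admissible, since the Luxemburg norm
of a midpoint is at most the larger of the two norms (`luxNorm_midpoint_le`). Convexity gives
`ψ(x, |∇m|) ≤ (ψ(x, |∇u₁|) + ψ(x, |∇u₂|)) / 2`, and by minimality the integrals of the two sides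
agree and are finite, so equality holds almost everywhere. Where `ω > 0`, strict convexity of
`φ(x, ·)` and of the Euclidean norm forces `∇u₁ = ∇u₂` (`eq_of_weighted_midpoint_eq`,
`weakGrad_ae_eq_of_isMinimizer`).

*Gradients determine the function.* By (A0) and (aInc)_p, `φ(x, t) ≥ c t^p` for `t ≥ T`, and
`t ≤ ω^{-1/(p-1)} + t^p ω` for all `t ≥ 0`; as `ω^{-1/(p-1)}` is locally integrable for `ω ∈ A_p`,
the space `L^ψ(Ω)` embeds into `L¹(Ω)` (`exists_lintegral_enorm_le_of_luxNorm_lt`). Approximating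
`u₁ - z` and `u₂ - z`, which have the same gradient, by test functions `η` and `θ`, one finds that
`∇η - ∇θ` is small in `L¹`, hence so is `η - θ` by the Poincaré inequality in `L¹`, and so
`u₁ - u₂` vanishes (`MemW10.ae_eq_of_weakGrad_ae_eq`).
-/

namespace WeightedOrlicz

variable {n : ℕ} {Ω : Set (E n)}

/-! ### Weak gradients -/

lemma integrableOn_smul_of_locallyIntegrableOn {F : Type*} [NormedAddCommGroup F]
    [NormedSpace ℝ F] {f : E n → F} (hf : LocallyIntegrableOn f Ω volume) {η : E n → ℝ}
    (hη : Continuous η) (hc : HasCompactSupport η) (hs : tsupport η ⊆ Ω) :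
    IntegrableOn (fun x => η x • f x) Ω volume := by
  have h1 : IntegrableOn (fun x => η x • f x) (tsupport η) volume :=
    (hf.integrableOn_compact_subset hs hc.isCompact).continuousOn_smul hη.continuousOn
      hc.isCompact
  refine Integrable.integrableOn ((integrableOn_iff_integrable_of_support_subset ?_).1 h1)
  exact (Function.support_smul_subset_left _ _).trans (subset_tsupport _)

lemma IsTestFunction.continuous_fderiv_apply {η : E n → ℝ} (hη : IsTestFunction Ω η) (v : E n) :
    Continuous fun x => fderiv ℝ η x v :=
  (hη.contDiff.continuous_fderiv (by simp)).clm_apply continuous_const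

lemma HasWeakGradient.integrableOn_mul_fderiv {u : E n → ℝ} {g : E n → E n}
    (h : HasWeakGradient Ω u g) {η : E n → ℝ} (hη : IsTestFunction Ω η) (v : E n) :
    IntegrableOn (fun x => u x * fderiv ℝ η x v) Ω volume := by
  have := integrableOn_smul_of_locallyIntegrableOn h.locallyIntegrableOn
    (hη.continuous_fderiv_apply v) (hη.hasCompactSupport.fderiv_apply ℝ v)
    ((tsupport_fderiv_apply_subset ℝ v).trans hη.tsupport_subset)
  simpa only [smul_eq_mul, mul_comm] using this

lemma HasWeakGradient.integrableOn_inner_mul {u : E n → ℝ} {g : E n → E n}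
    (h : HasWeakGradient Ω u g) {η : E n → ℝ} (hη : IsTestFunction Ω η) (v : E n) :
    IntegrableOn (fun x => inner ℝ (g x) v * η x) Ω volume := by
  have := integrableOn_smul_of_locallyIntegrableOn h.locallyIntegrableOn_grad
    hη.contDiff.continuous hη.hasCompactSupport hη.tsupport_subset
  refine (Integrable.inner_const this v).congr (ae_of_all _ fun x => ?_)
  simp only [real_inner_smul_left, mul_comm]

lemma HasWeakGradient.linear_comb {f g : E n → ℝ} {F G : E n → E n}
    (hf : HasWeakGradient Ω f F) (hg : HasWeakGradient Ω g G) (a b : ℝ) :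
    HasWeakGradient Ω (fun x => a * f x + b * g x) (fun x => a • F x + b • G x) where
  locallyIntegrableOn := (hf.locallyIntegrableOn.smul a).add (hg.locallyIntegrableOn.smul b)
  locallyIntegrableOn_grad :=
    (hf.locallyIntegrableOn_grad.smul a).add (hg.locallyIntegrableOn_grad.smul b)
  integral_eq η hη v := by
    have e1 : ∀ x, (a * f x + b * g x) * fderiv ℝ η x v =
      a * (f x * fderiv ℝ η x v) + b * (g x * fderiv ℝ η x v) := fun x => by ring
    have e2 : ∀ x, inner ℝ (a • F x + b • G x) v * η x =
      a * (inner ℝ (F x) v * η x) + b * (inner ℝ (G x) v * η x) := fun x => by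
        rw [inner_add_left, real_inner_smul_left, real_inner_smul_left]; ring
    simp only [e1, e2]
    rw [integral_add ((hf.integrableOn_mul_fderiv hη v).const_mul a)
        ((hg.integrableOn_mul_fderiv hη v).const_mul b),
      integral_add ((hf.integrableOn_inner_mul hη v).const_mul a)
        ((hg.integrableOn_inner_mul hη v).const_mul b)]
    simp only [integral_const_mul, hf.integral_eq η hη v, hg.integral_eq η hη v]
    ring

/-- Weak gradients are unique up to a null subset of the open set `Ω`, by the fundamental lemma
of the calculus of variations. -/
lemma HasWeakGradient.ae_eq (hΩ : IsOpen Ω) {u : E n → ℝ} {g g' : E n → E n}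
    (hg : HasWeakGradient Ω u g) (hg' : HasWeakGradient Ω u g') :
    g =ᵐ[volume.restrict Ω] g' := by
  have hsub := hg.linear_comb hg' 1 (-1)
  have key : ∀ᵐ x ∂volume, x ∈ Ω → (1 : ℝ) • g x + (-1 : ℝ) • g' x = 0 := by
    refine hΩ.ae_eq_zero_of_integral_contDiff_smul_eq_zero hsub.locallyIntegrableOn_grad ?_
    intro η h1 h2 h3
    have hη : IsTestFunction Ω η := ⟨h1, h2, h3⟩
    have hint := integrableOn_smul_of_locallyIntegrableOn hsub.locallyIntegrableOn_grad
      h1.continuous h2 h3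
    have hzero : ∫ x in Ω, η x • ((1 : ℝ) • g x + (-1 : ℝ) • g' x) = 0 := by
      refine ext_inner_right ℝ fun v => ?_
      have h := hsub.integral_eq η hη v
      simp only [one_mul, neg_mul, add_neg_cancel, zero_mul, integral_zero] at h
      rw [inner_zero_left, real_inner_comm, ← integral_inner hint]
      rw [zero_eq_neg] at h
      rw [← h]
      refine integral_congr_ae (ae_of_all _ fun x => ?_)
      simp only [real_inner_smul_right, real_inner_comm v]
      ring
    rw [← hzero, setIntegral_eq_integral_of_forall_compl_eq_zero]
    intro x hx
    rw [image_eq_zero_of_notMem_tsupport (fun h => hx (h3 h)), zero_smul]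
  rw [EventuallyEq, ae_restrict_iff' hΩ.measurableSet]
  filter_upwards [key] with x hx hxΩ
  have := hx hxΩ
  rwa [one_smul, neg_one_smul, ← sub_eq_add_neg, sub_eq_zero] at this

lemma hasWeakGradient_weakGrad {u : E n → ℝ} (h : ∃ g, HasWeakGradient Ω u g) :
    HasWeakGradient Ω u (weakGrad Ω u) := by
  rw [weakGrad, dif_pos h]
  exact h.choose_spec

lemma HasWeakGradient.weakGrad_ae_eq (hΩ : IsOpen Ω) {u : E n → ℝ} {g : E n → E n}
    (hg : HasWeakGradient Ω u g) : weakGrad Ω u =ᵐ[volume.restrict Ω] g :=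
  (hasWeakGradient_weakGrad ⟨g, hg⟩).ae_eq hΩ hg

lemma inner_gradient_left (η : E n → ℝ) (x v : E n) :
    inner ℝ (gradient η x) v = fderiv ℝ η x v := by
  rw [gradient, InnerProductSpace.toDual_symm_apply]

lemma norm_gradient (η : E n → ℝ) (x : E n) : ‖gradient η x‖ = ‖fderiv ℝ η x‖ := by
  rw [gradient, LinearIsometryEquiv.norm_map]

lemma IsTestFunction.continuous_gradient {η : E n → ℝ} (hη : IsTestFunction Ω η) :
    Continuous (gradient η) :=
  (InnerProductSpace.toDual ℝ (E n)).symm.continuous.comp (hη.contDiff.continuous_fderiv (by simp))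

lemma IsTestFunction.hasWeakGradient {η : E n → ℝ} (hη : IsTestFunction Ω η) :
    HasWeakGradient Ω η (gradient η) where
  locallyIntegrableOn := hη.contDiff.continuous.locallyIntegrable.locallyIntegrableOn Ω
  locallyIntegrableOn_grad := hη.continuous_gradient.locallyIntegrable.locallyIntegrableOn Ω
  integral_eq θ hθ v := by
    simp only [inner_gradient_left]
    rw [setIntegral_eq_integral_of_forall_compl_eq_zero,
      setIntegral_eq_integral_of_forall_compl_eq_zero]
    · have cη := hη.contDiff.continuous
      have cθ := hθ.contDiff.continuous
      refine integral_mul_fderiv_eq_neg_fderiv_mul_of_integrable ?_ ?_ ?_ ?_ ?_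
      · exact ((hη.continuous_fderiv_apply v).mul cθ).integrable_of_hasCompactSupport
          hθ.hasCompactSupport.mul_left
      · exact (cη.mul (hθ.continuous_fderiv_apply v)).integrable_of_hasCompactSupport
          hη.hasCompactSupport.mul_right
      · exact (cη.mul cθ).integrable_of_hasCompactSupport hη.hasCompactSupport.mul_right
      · exact fun x _ => (hη.contDiff.differentiable (by simp)) x
      · exact fun x _ => (hθ.contDiff.differentiable (by simp)) x
    · intro x hx
      rw [image_eq_zero_of_notMem_tsupport (fun h => hx (hθ.tsupport_subset h)), mul_zero]
    · intro x hx
      rw [image_eq_zero_of_notMem_tsupport (fun h => hx (hη.tsupport_subset h)), zero_mul]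

lemma IsTestFunction.linear_comb {η θ : E n → ℝ} (hη : IsTestFunction Ω η)
    (hθ : IsTestFunction Ω θ) (a b : ℝ) : IsTestFunction Ω fun x => a * η x + b * θ x where
  contDiff := (contDiff_const.mul hη.contDiff).add (contDiff_const.mul hθ.contDiff)
  hasCompactSupport := hη.hasCompactSupport.mul_left.add hθ.hasCompactSupport.mul_left
  tsupport_subset := by
    refine (tsupport_add _ _).trans (union_subset ?_ ?_)
    · exact (tsupport_mul_subset_right).trans hη.tsupport_subset
    · exact (tsupport_mul_subset_right).trans hθ.tsupport_subset

/-- The Poincaré inequality in `L¹` for test functions on a bounded set, a special case of the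
Gagliardo-Nirenberg-Sobolev inequality; the condition `1 < n` comes from the latter. -/
lemma exists_lintegral_enorm_le_gradient (hn : 2 ≤ n) (hΩb : Bornology.IsBounded Ω) :
    ∃ C : ℝ≥0, ∀ η : E n → ℝ, IsTestFunction Ω η →
      ∫⁻ x in Ω, ‖η x‖ₑ ≤ C * ∫⁻ x in Ω, ‖gradient η x‖ₑ := by
  refine ⟨eLpNormLESNormFDerivOfLeConst ℝ (volume : Measure (E n)) Ω 1 1, fun η hη => ?_⟩
  have h := eLpNorm_le_eLpNorm_fderiv_of_le (μ := (volume : Measure (E n))) (p := 1) (q := 1)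
    (hη.contDiff.of_le (by simp)) ((subset_tsupport _).trans hη.tsupport_subset) le_rfl
    (by simpa using (by exact_mod_cast hn : (1 : ℝ≥0) < n)) (by simp) hΩb
  simp only [ENNReal.coe_one, eLpNorm_one_eq_lintegral_enorm] at h
  have e : ∫⁻ x, ‖fderiv ℝ η x‖ₑ = ∫⁻ x in Ω, ‖gradient η x‖ₑ := by
    rw [← setLIntegral_eq_of_support_subset (s := Ω)]
    · refine lintegral_congr fun x => ?_
      rw [← ofReal_norm, ← ofReal_norm, norm_gradient]
    · intro x hx
      refine hη.tsupport_subset (support_fderiv_subset ℝ fun h0 => hx ?_)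
      dsimp only
      rw [← ofReal_norm, h0, norm_zero, ENNReal.ofReal_zero]
  rw [e] at h
  exact (setLIntegral_le_lintegral _ _).trans h

/-! ### Modulars and Luxemburg norms -/

section Luxemburg

variable {F : Type*} [NormedAddCommGroup F] {φ : E n → ℝ≥0 → ℝ≥0∞} {ω : E n → ℝ}

lemma aemeasurable_weighted (hφ : IsPhiPrefunction Ω φ) (hω : AEMeasurable ω volume)
    {f : E n → F} (hf : AEStronglyMeasurable f (volume.restrict Ω)) :
    AEMeasurable (fun x => weighted φ ω x ‖f x‖₊) (volume.restrict Ω) := by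
  have h := hφ.measurable (fun x => ‖f x‖) hf.norm.aemeasurable
  simp only [nnnorm_norm] at h
  exact h.mul hω.restrict.ennreal_ofReal

lemma weighted_mono (hφ : IsPhiPrefunction Ω φ) {x : E n} (hx : x ∈ Ω) :
    Monotone (weighted φ ω x) := fun _ _ h =>
  mul_le_mul_left (hφ.monotone x hx h) _

lemma weighted_midpoint_le (hφ : IsConvexPhi Ω φ) {x : E n} (hx : x ∈ Ω) (s t : ℝ≥0) :
    weighted φ ω x (2⁻¹ * s + 2⁻¹ * t) ≤
      2⁻¹ * weighted φ ω x s + 2⁻¹ * weighted φ ω x t := by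
  have h := hφ.convex x hx s t 2⁻¹ 2⁻¹ (by rw [← two_mul, mul_inv_cancel₀ two_ne_zero])
  rw [ENNReal.coe_inv two_ne_zero, ENNReal.coe_ofNat] at h
  calc weighted φ ω x (2⁻¹ * s + 2⁻¹ * t)
      ≤ (2⁻¹ * φ x s + 2⁻¹ * φ x t) * ENNReal.ofReal (ω x) := mul_le_mul_left h _
    _ = _ := by simp only [weighted]; ring

variable [NormedSpace ℝ F]

lemma nnnorm_midpoint_le (a b : F) :
    ‖(2⁻¹ : ℝ) • a + (2⁻¹ : ℝ) • b‖₊ ≤ 2⁻¹ * ‖a‖₊ + 2⁻¹ * ‖b‖₊ := by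
  refine (nnnorm_add_le _ _).trans (le_of_eq ?_)
  simp [nnnorm_smul]

lemma weighted_nnnorm_midpoint_le (hφ : IsConvexPhi Ω φ) {x : E n} (hx : x ∈ Ω) (a b : F) :
    weighted φ ω x ‖(2⁻¹ : ℝ) • a + (2⁻¹ : ℝ) • b‖₊ ≤
      2⁻¹ * weighted φ ω x ‖a‖₊ + 2⁻¹ * weighted φ ω x ‖b‖₊ :=
  (weighted_mono hφ.toIsPhiPrefunction hx (nnnorm_midpoint_le a b)).trans
    (weighted_midpoint_le hφ hx _ _)

lemma lintegral_half_add_half {f g : E n → ℝ≥0∞} (hf : AEMeasurable f (volume.restrict Ω)) :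
    ∫⁻ x in Ω, (2⁻¹ * f x + 2⁻¹ * g x) =
      2⁻¹ * (∫⁻ x in Ω, f x) + 2⁻¹ * ∫⁻ x in Ω, g x := by
  rw [lintegral_add_left' (hf.const_mul _), lintegral_const_mul' _ _ (by simp),
    lintegral_const_mul' _ _ (by simp)]

lemma exists_modular_le_one_of_luxNorm_lt {ψ : E n → ℝ≥0 → ℝ≥0∞} {f : E n → F} {c : ℝ≥0∞}
    (h : luxNorm Ω ψ f < c) :
    ∃ l : ℝ≥0, 0 < l ∧ (l : ℝ≥0∞) < c ∧ modular Ω ψ (fun x => (l : ℝ)⁻¹ • f x) ≤ 1 := by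
  simp only [luxNorm, iInf_lt_iff] at h
  obtain ⟨l, h0, h1, h2⟩ := h
  exact ⟨l, h0, h2, h1⟩

lemma luxNorm_le_of_modular_le_one {ψ : E n → ℝ≥0 → ℝ≥0∞} {f : E n → F} {l : ℝ≥0} (hl : 0 < l)
    (h : modular Ω ψ (fun x => (l : ℝ)⁻¹ • f x) ≤ 1) : luxNorm Ω ψ f ≤ l :=
  iInf_le_of_le l (iInf_le_of_le hl (iInf_le _ h))

lemma luxNorm_congr_ae {ψ : E n → ℝ≥0 → ℝ≥0∞} {f g : E n → F}
    (h : f =ᵐ[volume.restrict Ω] g) : luxNorm Ω ψ f = luxNorm Ω ψ g := by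
  have : ∀ l : ℝ≥0, modular Ω ψ (fun x => (l : ℝ)⁻¹ • f x) =
      modular Ω ψ (fun x => (l : ℝ)⁻¹ • g x) := fun l =>
    lintegral_congr_ae (by filter_upwards [h] with x hx; rw [hx])
  simp only [luxNorm, this]

/-- Quasiconvexity of the Luxemburg norm at midpoints. This weak form of the triangle inequality
is all that is needed of the norm. -/
lemma luxNorm_midpoint_le (hΩ : MeasurableSet Ω) (hφ : IsConvexPhi Ω φ)
    (hω : AEMeasurable ω volume) {f g : E n → F}
    (hf : AEStronglyMeasurable f (volume.restrict Ω)) :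
    luxNorm Ω (weighted φ ω) (fun x => (2⁻¹ : ℝ) • f x + (2⁻¹ : ℝ) • g x) ≤
      max (luxNorm Ω (weighted φ ω) f) (luxNorm Ω (weighted φ ω) g) := by
  refine le_of_forall_gt fun c hc => ?_
  obtain ⟨l₁, h₁, hc₁, hm₁⟩ := exists_modular_le_one_of_luxNorm_lt ((le_max_left _ _).trans_lt hc)
  obtain ⟨l₂, h₂, hc₂, hm₂⟩ := exists_modular_le_one_of_luxNorm_lt ((le_max_right _ _).trans_lt hc)
  refine (luxNorm_le_of_modular_le_one (l := max l₁ l₂) (lt_max_of_lt_left h₁) ?_).trans_lt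
    (by rw [ENNReal.coe_max]; exact max_lt hc₁ hc₂)
  have hshrink : ∀ (l : ℝ≥0) (a : F), 0 < l → l ≤ max l₁ l₂ →
      ‖((max l₁ l₂ : ℝ≥0) : ℝ)⁻¹ • a‖₊ ≤ ‖(l : ℝ)⁻¹ • a‖₊ := by
    intro l a hl hle
    rw [← NNReal.coe_inv, ← NNReal.coe_inv, nnnorm_smul, nnnorm_smul, NNReal.nnnorm_eq,
      NNReal.nnnorm_eq]
    gcongr
  calc modular Ω (weighted φ ω)
        (fun x => ((max l₁ l₂ : ℝ≥0) : ℝ)⁻¹ • ((2⁻¹ : ℝ) • f x + (2⁻¹ : ℝ) • g x))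
      ≤ ∫⁻ x in Ω, (2⁻¹ * weighted φ ω x ‖(l₁ : ℝ)⁻¹ • f x‖₊ +
          2⁻¹ * weighted φ ω x ‖(l₂ : ℝ)⁻¹ • g x‖₊) := by
        refine setLIntegral_mono' hΩ fun x hx => ?_
        dsimp only
        rw [smul_add, smul_comm _ (2⁻¹ : ℝ), smul_comm _ (2⁻¹ : ℝ)]
        refine (weighted_nnnorm_midpoint_le hφ hx _ _).trans ?_
        have hmono := weighted_mono (ω := ω) hφ.toIsPhiPrefunction hx
        gcongr
        · exact hmono (hshrink l₁ _ h₁ (le_max_left _ _))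
        · exact hmono (hshrink l₂ _ h₂ (le_max_right _ _))
    _ = 2⁻¹ * modular Ω (weighted φ ω) (fun x => (l₁ : ℝ)⁻¹ • f x) +
          2⁻¹ * modular Ω (weighted φ ω) (fun x => (l₂ : ℝ)⁻¹ • g x) :=
        lintegral_half_add_half
          (aemeasurable_weighted hφ.toIsPhiPrefunction hω (hf.const_smul _))
    _ ≤ 2⁻¹ * 1 + 2⁻¹ * 1 := by gcongr
    _ = 1 := by rw [mul_one, ENNReal.inv_two_add_inv_two]

lemma MemLPhi.midpoint (hΩ : MeasurableSet Ω) (hφ : IsConvexPhi Ω φ)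
    (hω : AEMeasurable ω volume) {f g : E n → F} (hf : MemLPhi Ω (weighted φ ω) f)
    (hg : MemLPhi Ω (weighted φ ω) g) :
    MemLPhi Ω (weighted φ ω) (fun x => (2⁻¹ : ℝ) • f x + (2⁻¹ : ℝ) • g x) :=
  ⟨(hf.1.const_smul _).add (hg.1.const_smul _),
    (luxNorm_midpoint_le hΩ hφ hω hf.1).trans_lt (max_lt hf.2 hg.2)⟩

end Luxemburg

/-! ### Control of the `L¹` norm by the Luxemburg norm -/

lemma IsMuckenhoupt.aemeasurable {p : ℝ} {ω : E n → ℝ} (hω : IsMuckenhoupt p ω) :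
    AEMeasurable ω volume :=
  hω.locallyIntegrable.aestronglyMeasurable.aemeasurable

lemma IsMuckenhoupt.lintegral_dual_lt_top {p : ℝ} (hp : 1 < p) {ω : E n → ℝ}
    (hω : IsMuckenhoupt p ω) (hΩb : Bornology.IsBounded Ω) :
    ∫⁻ x in Ω, ENNReal.ofReal (ω x) ^ (-(1 / (p - 1))) < ⊤ := by
  obtain ⟨r, hr, hΩr⟩ := hΩb.subset_ball_lt 0 (0 : E n)
  refine (lintegral_mono_set hΩr).trans_lt ?_
  have hB0 : volume (Metric.ball (0 : E n) r) ≠ 0 := (Metric.measure_ball_pos _ _ hr).ne'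
  have hBt : volume (Metric.ball (0 : E n) r) ≠ ⊤ := measure_ball_lt_top.ne
  have hprod : (⨍⁻ y in Metric.ball (0 : E n) r, ENNReal.ofReal (ω y) ∂volume) *
      (⨍⁻ y in Metric.ball (0 : E n) r, ENNReal.ofReal (ω y) ^ (-(1 / (p - 1))) ∂volume) ^ (p - 1)
      < ⊤ :=
    lt_of_le_of_lt (by
      rw [apConst]
      exact le_iSup_of_le (0 : E n) (le_iSup_of_le r (le_iSup (fun _ : 0 < r => _) hr)))
      hω.apConst_lt_top
  rw [setLAverage_eq, setLAverage_eq] at hprod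
  have hpos : ∫⁻ y in Metric.ball (0 : E n) r, ENNReal.ofReal (ω y) ≠ 0 := by
    rw [Ne, lintegral_eq_zero_iff' hω.aemeasurable.restrict.ennreal_ofReal]
    intro h
    have hbot : ∀ᵐ x ∂(volume.restrict (Metric.ball (0 : E n) r)), False := by
      filter_upwards [h, ae_restrict_of_ae hω.ae_pos] with x hx hx'
      exact absurd hx (ENNReal.ofReal_pos.2 hx').ne'
    rw [ae_iff] at hbot
    simp at hbot
    exact hB0 (by simpa using hbot)
  have hfac := ENNReal.lt_top_of_mul_ne_top_right hprod.ne (ENNReal.div_pos hpos hBt).ne'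
  rw [ENNReal.rpow_lt_top_iff_of_pos (by linarith)] at hfac
  rw [lt_top_iff_ne_top]
  intro htop
  rw [htop, ENNReal.top_div_of_ne_top hBt] at hfac
  exact lt_irrefl _ hfac

/-- If `t > ω^{-1/(p-1)}` then `t^{p-1} ω ≥ 1`, hence `t ≤ t^p ω`. This elementary dichotomy replaces
Hölder's inequality with the weight `ω`. -/
lemma le_dual_add_rpow_mul {p : ℝ} (hp : 1 < p) (t : ℝ≥0) {w : ℝ≥0∞} (hw0 : w ≠ 0)
    (hwt : w ≠ ⊤) : (t : ℝ≥0∞) ≤ w ^ (-(1 / (p - 1))) + (t : ℝ≥0∞) ^ p * w := by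
  have hp1 : 0 < p - 1 := by linarith
  rcases le_total (t : ℝ≥0∞) (w ^ (-(1 / (p - 1)))) with h | h
  · exact h.trans le_self_add
  · refine le_trans ?_ le_add_self
    have h1 : w⁻¹ ≤ (t : ℝ≥0∞) ^ (p - 1) := by
      have := ENNReal.rpow_le_rpow h hp1.le
      rwa [← ENNReal.rpow_mul, neg_mul, one_div, inv_mul_cancel₀ hp1.ne',
        ENNReal.rpow_neg_one] at this
    have h2 : (1 : ℝ≥0∞) ≤ (t : ℝ≥0∞) ^ (p - 1) * w := by
      calc (1 : ℝ≥0∞) = w⁻¹ * w := (ENNReal.inv_mul_cancel hw0 hwt).symm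
        _ ≤ _ := by gcongr
    have h3 : (t : ℝ≥0∞) ^ p = t * (t : ℝ≥0∞) ^ (p - 1) := by
      conv_lhs => rw [show p = 1 + (p - 1) by ring]
      rw [ENNReal.rpow_add_of_nonneg _ _ zero_le_one hp1.le, ENNReal.rpow_one]
    calc (t : ℝ≥0∞) = t * 1 := (mul_one _).symm
      _ ≤ t * ((t : ℝ≥0∞) ^ (p - 1) * w) := by gcongr
      _ = _ := by rw [h3, mul_assoc]

/-- Condition (A0) gives `φ(x, T) ≥ 1` with `T` independent of `x`, and (aInc)_p
turns this into growth of order `p` beyond `T`. -/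
lemma exists_rpow_le_phi {p : ℝ} (hΩ : MeasurableSet Ω) {φ : E n → ℝ≥0 → ℝ≥0∞}
    (hφ : IsPhiPrefunction Ω φ) (hA0 : CondA0 Ω φ) (hInc : CondAInc p Ω φ) :
    ∃ (T : ℝ≥0) (K : ℝ≥0∞), K ≠ ⊤ ∧ ∀ᵐ x ∂(volume.restrict Ω), ∀ t : ℝ≥0, T ≤ t →
      (t : ℝ≥0∞) ^ p ≤ K * φ x t := by
  obtain ⟨β, hβ, -, hA⟩ := hA0
  obtain ⟨L, -, hL⟩ := hInc
  have hT : 0 < 2 * β⁻¹ := by positivity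
  refine ⟨2 * β⁻¹, ((2 * β⁻¹ : ℝ≥0) : ℝ≥0∞) ^ p * L, ?_, ?_⟩
  · exact ENNReal.mul_ne_top (ENNReal.rpow_ne_top_of_ne_zero (by exact_mod_cast hT.ne')
      ENNReal.coe_ne_top) ENNReal.coe_ne_top
  filter_upwards [hA, ae_restrict_mem hΩ] with x hx hxΩ t ht
  have h1 : 1 ≤ φ x (2 * β⁻¹) := by
    have hlt : phiInv φ x 1 < ((2 * β⁻¹ : ℝ≥0) : ℝ≥0∞) := by
      refine hx.2.trans_lt ?_
      rw [← ENNReal.coe_inv hβ.ne', ENNReal.coe_lt_coe, two_mul]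
      exact lt_add_of_pos_left _ (by positivity)
    simp only [phiInv, iInf_lt_iff] at hlt
    obtain ⟨τ, h1, h2⟩ := hlt
    exact h1.trans (hφ.monotone x hxΩ (by exact_mod_cast h2.le))
  have ht0 : 0 < t := hT.trans_le ht
  have h2 := hL x hxΩ _ t hT ht
  generalize (2 * β⁻¹ : ℝ≥0) = T at *
  have eT : (T : ℝ≥0∞) ^ p * (T : ℝ≥0∞) ^ (-p) = 1 := by
    rw [← ENNReal.rpow_add _ _ (by exact_mod_cast hT.ne') ENNReal.coe_ne_top, add_neg_cancel,
      ENNReal.rpow_zero]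
  have et : (t : ℝ≥0∞) ^ p * (t : ℝ≥0∞) ^ (-p) = 1 := by
    rw [← ENNReal.rpow_add _ _ (by exact_mod_cast ht0.ne') ENNReal.coe_ne_top, add_neg_cancel,
      ENNReal.rpow_zero]
  calc (t : ℝ≥0∞) ^ p
      = (t : ℝ≥0∞) ^ p * ((T : ℝ≥0∞) ^ p * ((T : ℝ≥0∞) ^ (-p) * 1)) := by
        rw [mul_one, eT, mul_one]
    _ ≤ (t : ℝ≥0∞) ^ p * ((T : ℝ≥0∞) ^ p * (L * ((t : ℝ≥0∞) ^ (-p) * φ x t))) := by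
        exact mul_le_mul_right (mul_le_mul_right ((mul_le_mul_right h1 _).trans h2) _) _
    _ = (t : ℝ≥0∞) ^ p * (t : ℝ≥0∞) ^ (-p) * ((T : ℝ≥0∞) ^ p * L * φ x t) := by ring
    _ = _ := by rw [et, one_mul]

/-- The embedding of `L^ψ(Ω)` into `L¹(Ω)` for `ψ = φ ω`. -/
lemma exists_lintegral_enorm_le_of_luxNorm_lt {p : ℝ} (hp : 1 < p) (hΩ : MeasurableSet Ω)
    (hΩb : Bornology.IsBounded Ω) {ω : E n → ℝ} (hω : IsMuckenhoupt p ω)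
    {φ : E n → ℝ≥0 → ℝ≥0∞} (hφ : IsPhiPrefunction Ω φ) (hA0 : CondA0 Ω φ)
    (hInc : CondAInc p Ω φ) :
    ∃ C : ℝ≥0∞, C ≠ ⊤ ∧ ∀ {F : Type} [NormedAddCommGroup F] [NormedSpace ℝ F] (f : E n → F)
      (ε : ℝ≥0∞), luxNorm Ω (weighted φ ω) f < ε → ∫⁻ x in Ω, ‖f x‖ₑ ≤ C * ε := by
  obtain ⟨T, K, hK, hTK⟩ := exists_rpow_le_phi hΩ hφ hA0 hInc
  set D : ℝ≥0∞ := ∫⁻ x in Ω, ENNReal.ofReal (ω x) ^ (-(1 / (p - 1)))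
  have hDt : D < ⊤ := hω.lintegral_dual_lt_top hp hΩb
  refine ⟨T * volume Ω + D + K, ?_, ?_⟩
  · exact ENNReal.add_ne_top.2 ⟨ENNReal.add_ne_top.2
      ⟨ENNReal.mul_ne_top ENNReal.coe_ne_top hΩb.measure_lt_top.ne, hDt.ne⟩, hK⟩
  intro F _ _ f ε hε
  obtain ⟨l, hl, hlε, hm⟩ := exists_modular_le_one_of_luxNorm_lt hε
  have hbound : ∫⁻ x in Ω, ‖(l : ℝ)⁻¹ • f x‖ₑ ≤ T * volume Ω + D + K := by
    calc ∫⁻ x in Ω, ‖(l : ℝ)⁻¹ • f x‖ₑ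
        ≤ ∫⁻ x in Ω, ((T + ENNReal.ofReal (ω x) ^ (-(1 / (p - 1)))) +
            K * weighted φ ω x ‖(l : ℝ)⁻¹ • f x‖₊) := by
          refine lintegral_mono_ae ?_
          filter_upwards [hTK, ae_restrict_of_ae hω.ae_pos] with x hx hpos
          rw [enorm_eq_nnnorm]
          generalize ‖(l : ℝ)⁻¹ • f x‖₊ = t
          rcases le_total t T with h | h
          · exact (ENNReal.coe_le_coe.2 h).trans (le_self_add.trans le_self_add)
          · refine (le_dual_add_rpow_mul hp t (ENNReal.ofReal_pos.2 hpos).ne'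
              ENNReal.ofReal_ne_top).trans ?_
            refine add_le_add le_add_self ?_
            rw [weighted, ← mul_assoc]
            exact mul_le_mul_left (hx t h) _
      _ = T * volume Ω + D + K * modular Ω (weighted φ ω) (fun x => (l : ℝ)⁻¹ • f x) := by
          rw [lintegral_add_left', lintegral_add_left' aemeasurable_const,
            lintegral_const_mul' _ _ hK, setLIntegral_const, modular]
          exact aemeasurable_const.add (hω.aemeasurable.restrict.ennreal_ofReal.pow_const _)
      _ ≤ T * volume Ω + D + K * 1 := by gcongr
      _ = _ := by rw [mul_one]
  calc ∫⁻ x in Ω, ‖f x‖ₑ = ∫⁻ x in Ω, l * ‖(l : ℝ)⁻¹ • f x‖ₑ := by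
        refine lintegral_congr fun x => ?_
        rw [← NNReal.coe_inv, enorm_smul, ← mul_assoc, enorm_eq_nnnorm (_ : ℝ), NNReal.nnnorm_eq,
          ← ENNReal.coe_mul, mul_inv_cancel₀ hl.ne', ENNReal.coe_one, one_mul]
    _ = l * ∫⁻ x in Ω, ‖(l : ℝ)⁻¹ • f x‖ₑ := lintegral_const_mul' _ _ ENNReal.coe_ne_top
    _ ≤ ε * (T * volume Ω + D + K) := by gcongr
    _ = _ := mul_comm _ _

/-! ### Consequences of strict convexity -/

lemma IsStrictlyConvexPhi.midpoint_lt {φ : E n → ℝ≥0 → ℝ≥0∞} (h : IsStrictlyConvexPhi Ω φ)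
    {x : E n} (hx : x ∈ Ω) {s t : ℝ≥0} (hst : s ≠ t) (hs : φ x s ≠ ⊤) (ht : φ x t ≠ ⊤) :
    φ x (2⁻¹ * s + 2⁻¹ * t) < 2⁻¹ * φ x s + 2⁻¹ * φ x t := by
  have := h x hx s t 2⁻¹ 2⁻¹ hst hs ht (by positivity) (by positivity)
    (by rw [← two_mul, mul_inv_cancel₀ two_ne_zero])
  rwa [ENNReal.coe_inv two_ne_zero, ENNReal.coe_ofNat] at this

lemma half_mul_add_half_mul (c : ℝ≥0∞) : 2⁻¹ * c + 2⁻¹ * c = c := by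
  rw [← add_mul, ENNReal.inv_two_add_inv_two, one_mul]

lemma half_mul_add_half_mul_nnreal (c : ℝ≥0) : 2⁻¹ * c + 2⁻¹ * c = c := by
  rw [← add_mul, ← two_mul, mul_inv_cancel₀ two_ne_zero, one_mul]

lemma phi_lt_of_lt {φ : E n → ℝ≥0 → ℝ≥0∞} (hφ : IsPhiPrefunction Ω φ)
    (h : IsStrictlyConvexPhi Ω φ) {x : E n} (hx : x ∈ Ω) {s t : ℝ≥0} (hst : s < t)
    (ht : φ x t ≠ ⊤) : φ x s < φ x t := by
  have hle := hφ.monotone x hx hst.le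
  refine lt_of_le_of_ne hle fun heq => ?_
  -- A constant stretch of `φ x` would contain the midpoint of `s` and `t`.
  have h1 := h.midpoint_lt hx hst.ne (heq ▸ ht) ht
  rw [← heq, half_mul_add_half_mul] at h1
  refine h1.not_ge (hφ.monotone x hx ?_)
  calc s = 2⁻¹ * s + 2⁻¹ * s := (half_mul_add_half_mul_nnreal s).symm
    _ ≤ _ := by gcongr

/-- Equality in the midpoint inequality for `v ↦ φ(x, |v|)` forces `a = b`: strict convexity of
`φ x` gives `|a| = |b|`, strict monotonicity gives equality in the triangle inequality, and
the Euclidean norm is strictly convex. -/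
lemma eq_of_phi_midpoint_eq {φ : E n → ℝ≥0 → ℝ≥0∞} (hφ : IsPhiPrefunction Ω φ)
    (h : IsStrictlyConvexPhi Ω φ) {x : E n} (hx : x ∈ Ω) {a b : E n}
    (ha : φ x ‖a‖₊ ≠ ⊤) (hb : φ x ‖b‖₊ ≠ ⊤)
    (heq : φ x ‖(2⁻¹ : ℝ) • a + (2⁻¹ : ℝ) • b‖₊ = 2⁻¹ * φ x ‖a‖₊ + 2⁻¹ * φ x ‖b‖₊) :
    a = b := by
  have hmid := nnnorm_midpoint_le a b
  have hab : ‖a‖₊ = ‖b‖₊ := by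
    by_contra hne
    exact ((hφ.monotone x hx hmid).trans_lt (h.midpoint_lt hx hne ha hb)).ne heq
  rw [← hab, half_mul_add_half_mul] at heq
  rw [← hab, half_mul_add_half_mul_nnreal] at hmid
  have hnorm : ‖(2⁻¹ : ℝ) • a + (2⁻¹ : ℝ) • b‖₊ = ‖a‖₊ := by
    refine hmid.antisymm (not_lt.1 fun hlt => ?_)
    exact (phi_lt_of_lt hφ h hx hlt ha).ne heq
  have hab' : ‖a‖ = ‖b‖ := congrArg NNReal.toReal hab
  refine eq_of_norm_eq_of_norm_add_eq hab' ?_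
  have hnorm' : ‖(2⁻¹ : ℝ) • a + (2⁻¹ : ℝ) • b‖ = ‖a‖ := congrArg NNReal.toReal hnorm
  rw [← smul_add, norm_smul, Real.norm_of_nonneg (by norm_num)] at hnorm'
  linarith

lemma eq_of_weighted_midpoint_eq {φ : E n → ℝ≥0 → ℝ≥0∞} {ω : E n → ℝ}
    (hφ : IsPhiPrefunction Ω φ) (h : IsStrictlyConvexPhi Ω φ) {x : E n} (hx : x ∈ Ω)
    (hω : 0 < ω x) {a b : E n} (ha : weighted φ ω x ‖a‖₊ ≠ ⊤) (hb : weighted φ ω x ‖b‖₊ ≠ ⊤)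
    (heq : weighted φ ω x ‖(2⁻¹ : ℝ) • a + (2⁻¹ : ℝ) • b‖₊ =
      2⁻¹ * weighted φ ω x ‖a‖₊ + 2⁻¹ * weighted φ ω x ‖b‖₊) : a = b := by
  have hw0 : ENNReal.ofReal (ω x) ≠ 0 := (ENNReal.ofReal_pos.2 hω).ne'
  refine eq_of_phi_midpoint_eq hφ h hx (fun h0 => ha ?_) (fun h0 => hb ?_) ?_
  · rw [weighted, h0, ENNReal.top_mul hw0]
  · rw [weighted, h0, ENNReal.top_mul hw0]
  · simp only [weighted, ← mul_assoc, ← add_mul] at heq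
    exact (ENNReal.mul_left_inj hw0 ENNReal.ofReal_ne_top).1 heq

/-! ### The admissible class and its minimizers -/

lemma HasWeakGradient.sub {f g : E n → ℝ} {F G : E n → E n} (hf : HasWeakGradient Ω f F)
    (hg : HasWeakGradient Ω g G) :
    HasWeakGradient Ω (fun x => f x - g x) (fun x => F x - G x) := by
  simpa [← sub_eq_add_neg] using hf.linear_comb hg 1 (-1)

lemma HasWeakGradient.add {f g : E n → ℝ} {F G : E n → E n} (hf : HasWeakGradient Ω f F)
    (hg : HasWeakGradient Ω g G) :
    HasWeakGradient Ω (fun x => f x + g x) (fun x => F x + G x) := by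
  simpa using hf.linear_comb hg 1 1

lemma HasWeakGradient.aestronglyMeasurable {f : E n → ℝ} {F : E n → E n}
    (hf : HasWeakGradient Ω f F) : AEStronglyMeasurable f (volume.restrict Ω) :=
  hf.locallyIntegrableOn.aestronglyMeasurable

lemma HasWeakGradient.aestronglyMeasurable_grad {f : E n → ℝ} {F : E n → E n}
    (hf : HasWeakGradient Ω f F) : AEStronglyMeasurable F (volume.restrict Ω) :=
  hf.locallyIntegrableOn_grad.aestronglyMeasurable

section Midpoint

variable {φ : E n → ℝ≥0 → ℝ≥0∞} {ω : E n → ℝ}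

lemma sobolevNorm_midpoint_lt (hΩ : IsOpen Ω) (hφ : IsConvexPhi Ω φ)
    (hω : AEMeasurable ω volume) {f g : E n → ℝ} {F G : E n → E n}
    (hf : HasWeakGradient Ω f F) (hg : HasWeakGradient Ω g G) {ε : ℝ≥0∞}
    (hfε : sobolevNorm Ω (weighted φ ω) f < ε / 2)
    (hgε : sobolevNorm Ω (weighted φ ω) g < ε / 2) :
    sobolevNorm Ω (weighted φ ω) (fun x => 2⁻¹ * f x + 2⁻¹ * g x) < ε := by
  have hf' := hasWeakGradient_weakGrad ⟨F, hf⟩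
  have hg' := hasWeakGradient_weakGrad ⟨G, hg⟩
  have h1 := luxNorm_midpoint_le (g := g) hΩ.measurableSet hφ hω hf.aestronglyMeasurable
  have h2 := luxNorm_midpoint_le (g := weakGrad Ω g) hΩ.measurableSet hφ hω
    hf'.aestronglyMeasurable_grad
  rw [← luxNorm_congr_ae ((hf'.linear_comb hg' 2⁻¹ 2⁻¹).weakGrad_ae_eq hΩ)] at h2
  simp only [smul_eq_mul] at h1
  rw [sobolevNorm] at *
  rw [← ENNReal.add_halves ε]
  refine ENNReal.add_lt_add (h1.trans_lt ?_) (h2.trans_lt ?_)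
  · exact max_lt (le_self_add.trans_lt hfε) (le_self_add.trans_lt hgε)
  · exact max_lt (le_add_self.trans_lt hfε) (le_add_self.trans_lt hgε)

lemma MemW1.midpoint (hΩ : IsOpen Ω) (hφ : IsConvexPhi Ω φ) (hω : AEMeasurable ω volume)
    {f g : E n → ℝ} (hf : MemW1 Ω (weighted φ ω) f) (hg : MemW1 Ω (weighted φ ω) g) :
    MemW1 Ω (weighted φ ω) (fun x => 2⁻¹ * f x + 2⁻¹ * g x) := by
  have h := (hasWeakGradient_weakGrad hf.exists_grad).linear_comb
    (hasWeakGradient_weakGrad hg.exists_grad) 2⁻¹ 2⁻¹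
  have hae := h.weakGrad_ae_eq hΩ
  have hm := hf.memLPhi_grad.midpoint hΩ.measurableSet hφ hω hg.memLPhi_grad
  refine ⟨⟨_, h⟩, ?_, hm.1.congr hae.symm, (luxNorm_congr_ae hae).trans_lt hm.2⟩
  simpa only [smul_eq_mul] using hf.memLPhi.midpoint hΩ.measurableSet hφ hω hg.memLPhi

lemma MemW10.midpoint (hΩ : IsOpen Ω) (hφ : IsConvexPhi Ω φ) (hω : AEMeasurable ω volume)
    {f g : E n → ℝ} (hf : MemW10 Ω (weighted φ ω) f) (hg : MemW10 Ω (weighted φ ω) g) :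
    MemW10 Ω (weighted φ ω) (fun x => 2⁻¹ * f x + 2⁻¹ * g x) where
  memW1 := hf.memW1.midpoint hΩ hφ hω hg.memW1
  exists_approx ε hε := by
    obtain ⟨η, hη, hfη⟩ := hf.exists_approx (ε / 2) (ENNReal.half_pos hε.ne')
    obtain ⟨θ, hθ, hgθ⟩ := hg.exists_approx (ε / 2) (ENNReal.half_pos hε.ne')
    refine ⟨_, hη.linear_comb hθ 2⁻¹ 2⁻¹, ?_⟩
    have h := sobolevNorm_midpoint_lt hΩ hφ hω
      ((hasWeakGradient_weakGrad hf.memW1.exists_grad).sub hη.hasWeakGradient)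
      ((hasWeakGradient_weakGrad hg.memW1.exists_grad).sub hθ.hasWeakGradient) hfη hgθ
    convert h using 2
    ext x
    ring

lemma exists_grad_of_mem_admissible {ψ : E n → ℝ≥0 → ℝ≥0∞} {z u : E n → ℝ}
    (hz : MemW1 Ω ψ z) (hu : u ∈ admissible Ω ψ z) :
    HasWeakGradient Ω u (fun x => weakGrad Ω (fun y => u y - z y) x + weakGrad Ω z x) := by
  simpa using (hasWeakGradient_weakGrad hu.memW1.exists_grad).add
    (hasWeakGradient_weakGrad hz.exists_grad)

/-- The midpoint of two minimizers is admissible, so its energy is at least the average of theirs;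
convexity makes the integrands agree almost everywhere. -/
lemma weakGrad_ae_eq_of_isMinimizer (hΩ : IsOpen Ω) (hφ : IsConvexPhi Ω φ)
    (hstrict : IsStrictlyConvexPhi Ω φ) (hω : AEMeasurable ω volume) (hpos : ∀ᵐ x, 0 < ω x)
    {z u₁ u₂ : E n → ℝ} (hz : MemW1 Ω (weighted φ ω) z)
    (hfin : ∃ v ∈ admissible Ω (weighted φ ω) z, energy Ω (weighted φ ω) v < ⊤)
    (h₁ : IsMinimizer Ω (weighted φ ω) z u₁) (h₂ : IsMinimizer Ω (weighted φ ω) z u₂) :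
    weakGrad Ω u₁ =ᵐ[volume.restrict Ω] weakGrad Ω u₂ := by
  obtain ⟨v, hv, hvt⟩ := hfin
  have hg₁ := hasWeakGradient_weakGrad ⟨_, exists_grad_of_mem_admissible hz h₁.1⟩
  have hg₂ := hasWeakGradient_weakGrad ⟨_, exists_grad_of_mem_admissible hz h₂.1⟩
  have hmin : energy Ω (weighted φ ω) u₁ = energy Ω (weighted φ ω) u₂ := h₁.2.trans h₂.2.symm
  have ht₁ : energy Ω (weighted φ ω) u₁ < ⊤ := by
    rw [h₁.2]
    exact (iInf₂_le v hv).trans_lt hvt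
  have hm : (fun x => 2⁻¹ * u₁ x + 2⁻¹ * u₂ x) ∈ admissible Ω (weighted φ ω) z := by
    have h := MemW10.midpoint hΩ hφ hω h₁.1 h₂.1
    change MemW10 Ω (weighted φ ω) _
    convert h using 2
    ring
  have hmeas₁ := aemeasurable_weighted hφ.toIsPhiPrefunction hω
    hg₁.aestronglyMeasurable_grad
  have hmeas₂ := aemeasurable_weighted hφ.toIsPhiPrefunction hω
    hg₂.aestronglyMeasurable_grad
  set f₁ : E n → ℝ≥0∞ := fun x => weighted φ ω x ‖weakGrad Ω u₁ x‖₊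
  set f₂ : E n → ℝ≥0∞ := fun x => weighted φ ω x ‖weakGrad Ω u₂ x‖₊
  set h : E n → ℝ≥0∞ := fun x =>
    weighted φ ω x ‖(2⁻¹ : ℝ) • weakGrad Ω u₁ x + (2⁻¹ : ℝ) • weakGrad Ω u₂ x‖₊ with hh
  have e₁ : ∫⁻ x in Ω, f₁ x = energy Ω (weighted φ ω) u₁ := rfl
  have e₂ : ∫⁻ x in Ω, f₂ x = energy Ω (weighted φ ω) u₁ := hmin.symm
  have hle : h ≤ᵐ[volume.restrict Ω] fun x => 2⁻¹ * f₁ x + 2⁻¹ * f₂ x := by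
    filter_upwards [ae_restrict_mem hΩ.measurableSet] with x hx
    exact weighted_nnnorm_midpoint_le hφ hx _ _
  have havg : ∫⁻ x in Ω, (2⁻¹ * f₁ x + 2⁻¹ * f₂ x) = energy Ω (weighted φ ω) u₁ := by
    rw [lintegral_half_add_half hmeas₁, e₁, e₂, half_mul_add_half_mul]
  have hge : energy Ω (weighted φ ω) u₁ ≤ ∫⁻ x in Ω, h x := by
    calc energy Ω (weighted φ ω) u₁
        ≤ energy Ω (weighted φ ω) (fun x => 2⁻¹ * u₁ x + 2⁻¹ * u₂ x) := by
          rw [h₁.2]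
          exact iInf₂_le _ hm
      _ = ∫⁻ x in Ω, h x := by
          refine lintegral_congr_ae ?_
          filter_upwards [(hg₁.linear_comb hg₂ 2⁻¹ 2⁻¹).weakGrad_ae_eq hΩ] with x hx
          rw [hh, hx]
  have heq : h =ᵐ[volume.restrict Ω] fun x => 2⁻¹ * f₁ x + 2⁻¹ * f₂ x := by
    refine ae_eq_of_ae_le_of_lintegral_le hle ?_ ((hmeas₁.const_mul _).add (hmeas₂.const_mul _))
      (havg.le.trans hge)
    exact ((lintegral_mono_ae hle).trans_lt (havg.trans_lt ht₁)).ne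
  filter_upwards [heq, ae_restrict_mem hΩ.measurableSet, ae_restrict_of_ae hpos,
    ae_lt_top' hmeas₁ (e₁.trans_lt ht₁).ne, ae_lt_top' hmeas₂ (e₂.trans_lt ht₁).ne]
    with x hx hxΩ hxω hx₁ hx₂
  exact eq_of_weighted_midpoint_eq hφ.toIsPhiPrefunction hstrict hxΩ hxω hx₁.ne hx₂.ne hx

end Midpoint

/-- Two functions of `W_0^{1,ψ}(Ω)` with the same gradient agree: their approximations by test
functions have `L¹`-close gradients, and the Poincaré inequality applies to the difference of the
approximations. -/
lemma MemW10.ae_eq_of_weakGrad_ae_eq (hn : 2 ≤ n) {p : ℝ} (hp : 1 < p) (hΩ : IsOpen Ω)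
    (hΩb : Bornology.IsBounded Ω) {ω : E n → ℝ} (hω : IsMuckenhoupt p ω)
    {φ : E n → ℝ≥0 → ℝ≥0∞} (hφ : IsPhiPrefunction Ω φ) (hA0 : CondA0 Ω φ)
    (hInc : CondAInc p Ω φ) {f g : E n → ℝ} (hf : MemW10 Ω (weighted φ ω) f)
    (hg : MemW10 Ω (weighted φ ω) g)
    (hfg : weakGrad Ω f =ᵐ[volume.restrict Ω] weakGrad Ω g) :
    f =ᵐ[volume.restrict Ω] g := by
  obtain ⟨C, hC, hemb⟩ :=
    exists_lintegral_enorm_le_of_luxNorm_lt hp hΩ.measurableSet hΩb hω hφ hA0 hInc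
  obtain ⟨K, hK⟩ := exists_lintegral_enorm_le_gradient hn hΩb
  have hgf := hasWeakGradient_weakGrad hf.memW1.exists_grad
  have hgg := hasWeakGradient_weakGrad hg.memW1.exists_grad
  have happrox : ∀ {u : E n → ℝ}, MemW10 Ω (weighted φ ω) u → ∀ ε : ℝ≥0∞, 0 < ε →
      ∃ η : E n → ℝ, IsTestFunction Ω η ∧ ∫⁻ x in Ω, ‖u x - η x‖ₑ ≤ C * ε ∧
        ∫⁻ x in Ω, ‖weakGrad Ω u x - gradient η x‖ₑ ≤ C * ε := by
    intro u hu ε hε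
    obtain ⟨η, hη, hlt⟩ := hu.exists_approx ε hε
    rw [sobolevNorm] at hlt
    refine ⟨η, hη, hemb _ ε (le_self_add.trans_lt hlt), hemb _ ε ?_⟩
    rw [← luxNorm_congr_ae (((hasWeakGradient_weakGrad hu.memW1.exists_grad).sub
      hη.hasWeakGradient).weakGrad_ae_eq hΩ)]
    exact le_add_self.trans_lt hlt
  have hbound : ∀ ε : ℝ≥0∞, 0 < ε →
      ∫⁻ x in Ω, ‖f x - g x‖ₑ ≤ (C + C + K * (C + C)) * ε := by
    intro ε hε
    obtain ⟨η, hη, hη0, hη1⟩ := happrox hf ε hε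
    obtain ⟨θ, hθ, hθ0, hθ1⟩ := happrox hg ε hε
    have hmf : AEMeasurable (fun x => ‖f x - η x‖ₑ) (volume.restrict Ω) :=
      (hgf.aestronglyMeasurable.sub
        hη.contDiff.continuous.aestronglyMeasurable).enorm
    have hmg : AEMeasurable (fun x => ‖g x - θ x‖ₑ) (volume.restrict Ω) :=
      (hgg.aestronglyMeasurable.sub
        hθ.contDiff.continuous.aestronglyMeasurable).enorm
    have hmG : AEMeasurable (fun x => ‖weakGrad Ω f x - gradient η x‖ₑ) (volume.restrict Ω) :=
      (hgf.aestronglyMeasurable_grad.sub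
        hη.continuous_gradient.aestronglyMeasurable).enorm
    have hdiff : IsTestFunction Ω fun x => η x - θ x := by
      simpa [← sub_eq_add_neg] using hη.linear_comb hθ 1 (-1)
    have hgrad : ∀ x, gradient (fun y => η y - θ y) x = gradient η x - gradient θ x := by
      intro x
      simp only [gradient]
      rw [fderiv_fun_sub (hη.contDiff.differentiable (by simp) x)
        (hθ.contDiff.differentiable (by simp) x), map_sub]
    have hpoin : ∫⁻ x in Ω, ‖η x - θ x‖ₑ ≤ K * (C * ε + C * ε) := by
      calc ∫⁻ x in Ω, ‖η x - θ x‖ₑ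
          ≤ K * ∫⁻ x in Ω, ‖gradient η x - gradient θ x‖ₑ := by
            simpa only [hgrad] using hK _ hdiff
        _ ≤ K * ∫⁻ x in Ω, (‖weakGrad Ω f x - gradient η x‖ₑ +
              ‖weakGrad Ω g x - gradient θ x‖ₑ) := by
            refine mul_le_mul_right (lintegral_mono_ae ?_) _
            filter_upwards [hfg] with x hx
            rw [show gradient η x - gradient θ x =
              (weakGrad Ω g x - gradient θ x) - (weakGrad Ω f x - gradient η x) by rw [hx]; abel,
              add_comm]
            exact enorm_sub_le
        _ ≤ K * (C * ε + C * ε) := by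
            rw [lintegral_add_left' hmG]
            gcongr
    calc ∫⁻ x in Ω, ‖f x - g x‖ₑ
        ≤ ∫⁻ x in Ω, (‖f x - η x‖ₑ + (‖g x - θ x‖ₑ + ‖η x - θ x‖ₑ)) := by
          refine lintegral_mono fun x => ?_
          rw [show f x - g x = (f x - η x) - ((g x - θ x) - (η x - θ x)) by ring]
          exact enorm_sub_le.trans (add_le_add_right enorm_sub_le _)
      _ ≤ C * ε + (C * ε + K * (C * ε + C * ε)) := by
          rw [lintegral_add_left' hmf, lintegral_add_left' hmg]
          gcongr
      _ = (C + C + K * (C + C)) * ε := by ring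
  have hzero : ∫⁻ x in Ω, ‖f x - g x‖ₑ = 0 := by
    have hM : C + C + K * (C + C) ≠ ⊤ := by finiteness
    have hlim : Tendsto (fun ε : ℝ≥0∞ => (C + C + K * (C + C)) * ε) (𝓝[>] 0) (𝓝 0) := by
      have h := (ENNReal.continuous_const_mul hM).tendsto 0
      rw [mul_zero] at h
      exact h.mono_left nhdsWithin_le_nhds
    exact le_antisymm (ge_of_tendsto hlim
      (eventually_nhdsWithin_of_forall fun ε hε => hbound ε hε)) zero_le
  have hmfg : AEMeasurable (fun x => ‖f x - g x‖ₑ) (volume.restrict Ω) :=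
    (hgf.aestronglyMeasurable.sub hgg.aestronglyMeasurable).enorm
  rw [lintegral_eq_zero_iff' hmfg] at hzero
  filter_upwards [hzero] with x hx
  simpa [sub_eq_zero] using hx

end WeightedOrlicz

theorem theorem3p8 (n : ℕ) (hn : 2 ≤ n) (p : ℝ) (hp : 1 < p)
    (Ω : Set (WeightedOrlicz.E n)) (hΩo : IsOpen Ω) (hΩc : IsConnected Ω)
    (hΩb : Bornology.IsBounded Ω)
    (ω : WeightedOrlicz.E n → ℝ) (hω : WeightedOrlicz.IsMuckenhoupt p ω)
    (φ : WeightedOrlicz.E n → ℝ≥0 → ℝ≥0∞)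
    (hφ : WeightedOrlicz.IsConvexPhi Ω φ)
    (hstrict : WeightedOrlicz.IsStrictlyConvexPhi Ω φ)
    (hA0 : WeightedOrlicz.CondA0 Ω φ)
    (hInc : WeightedOrlicz.CondAInc p Ω φ)
    (z : WeightedOrlicz.E n → ℝ)
    (hz : WeightedOrlicz.MemW1 Ω (WeightedOrlicz.weighted φ ω) z)
    (hfin : ∃ v ∈ WeightedOrlicz.admissible Ω (WeightedOrlicz.weighted φ ω) z,
      WeightedOrlicz.energy Ω (WeightedOrlicz.weighted φ ω) v < ⊤)
    (u₁ u₂ : WeightedOrlicz.E n → ℝ)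
    (h₁ : WeightedOrlicz.IsMinimizer Ω (WeightedOrlicz.weighted φ ω) z u₁)
    (h₂ : WeightedOrlicz.IsMinimizer Ω (WeightedOrlicz.weighted φ ω) z u₂) :
    ∀ᵐ x ∂(volume.restrict Ω), u₁ x = u₂ x := by
  have hgrad := WeightedOrlicz.weakGrad_ae_eq_of_isMinimizer hΩo hφ hstrict hω.aemeasurable
    hω.ae_pos hz hfin h₁ h₂
  have e₁ := (WeightedOrlicz.exists_grad_of_mem_admissible hz h₁.1).weakGrad_ae_eq hΩo
  have e₂ := (WeightedOrlicz.exists_grad_of_mem_admissible hz h₂.1).weakGrad_ae_eq hΩo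
  have heq := WeightedOrlicz.MemW10.ae_eq_of_weakGrad_ae_eq hn hp hΩo hΩb hω
    hφ.toIsPhiPrefunction hA0 hInc h₁.1 h₂.1 (by
      filter_upwards [hgrad, e₁, e₂] with x hx hx₁ hx₂
      rw [hx₁, hx₂] at hx
      exact add_right_cancel hx)
  filter_upwards [heq] with x hx
  exact sub_left_injective hx
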